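/- Let $N,S,R$ be nonnegative integers, let $\Delta\subseteq\{0,1\}^N$ and let $g:\Delta\to\{0,1\}$ be a partial Boolean function. \emph{Query complexity.} For a total function $f:\{0,1\}^N\to\{0,1\}$, $D(f)$ is the minimal depth of a deterministic decision tree computing $f$; for the partial function $g$, $D(g)=\min\{D(f) : f:\{0,1\}^N\to\{0,1\},\ f(x)=g(x)\text{ for all }x\in\Delta\}$. \emph{The AMPC model.} A data store is a finite multiset of key-value pairs. The keys include the indices $1,\dots,N$ and a further symbol $\textsc{answer}$, the values include the bits $0,1$; querying a key returns the multiset of all values stored under it (possibly empty). A deterministic AMPC algorithm has a finite set of machines and proceeds in rounds. On input $x\in\{0,1\}^N$ the initial store $\mathcal D_0$ consists of the pairs $(i,x_i)$, $1\le i\le N$. In round $r\ge 1$ each machine adaptively queries keys of $\mathcal D_{r-1}$ (each query, and finally the multiset of pairs it writes, is determined by the machine, the round, and the earlier queries and responses of that machine in that round), and $\mathcal D_r$ is the multiset union of what all the machines write in round $r$. The read cost of a machine in a round is the total number of values in all its responses plus the number of its queries with an empty response; a machine whose read cost would exceed the I/O capacity $S$ is stopped and writes nothing in that round. The algorithm \emph{computes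 $g$ in $R$ rounds with I/O capacity $S$} if (1) on every input $x\in\Delta$, in each of the rounds $1,\dots,R$, each machine has read cost at most $S$ and writes at most $S$ pairs; (2) on every input $x\in\{0,1\}^N$ (in $\Delta$ or not), in each of the rounds $1,\dots,R$, at most $S$ values, counted with multiplicity, are written under any single key; (3) on every input $x\in\Delta$, $\mathcal D_R$ consists of the single pair $(\textsc{answer},g(x))$. \emph{Theorem.} If some deterministic AMPC algorithm computes $g$ in $R$ rounds with I/O capacity $S$, then $$D(g)\le 2S^{6R}.$$ In particular, if $S\ge 2$, then $R\ge\frac16\log_S\frac{D(g)}{2}$ (which is trivially true when $D(g)=0$, where $\log_S 0$ is read as $-\infty$). -/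

import Mathlib

namespace AMPC

/-! ### Deterministic query complexity -/

/-- A deterministic decision tree on `N` input bits: a leaf outputs a bit, an inner node queries one
input bit and branches on its value. -/
inductive DecisionTree (N : ℕ) : Type where
  | leaf (b : Bool) : DecisionTree N
  | query (i : Fin N) (next : Bool → DecisionTree N) : DecisionTree N

namespace DecisionTree

/-- The output of a decision tree on the input `x`. -/
def eval {N : ℕ} (x : Fin N → Bool) : DecisionTree N → Bool
  | leaf b => b
  | query i next => eval x (next (x i))

/-- The depth of a decision tree: the maximal number of queries on a root-to-leaf path. -/
def depth {N : ℕ} : DecisionTree N → ℕ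
  | leaf _ => 0
  | query _ next => max (depth (next false)) (depth (next true)) + 1

end DecisionTree

/-- Every total Boolean function is computed by some decision tree, so that the minimum in
`queryComplexity` is over a nonempty set. -/
theorem exists_decisionTree {N : ℕ} (f : (Fin N → Bool) → Bool) :
    ∃ T : DecisionTree N, ∀ x, T.eval x = f x := by
  have key : ∀ (s : Finset (Fin N)) (f : (Fin N → Bool) → Bool),
      (∀ x y : Fin N → Bool, (∀ i ∈ s, x i = y i) → f x = f y) →
      ∃ T : DecisionTree N, ∀ x, T.eval x = f x := by
    intro s
    induction s using Finset.induction_on with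
    | empty =>
      intro f hf
      exact ⟨.leaf (f fun _ => false), fun x => hf _ _ (by simp)⟩
    | insert a s _ ih =>
      intro f hf
      have h : ∀ b : Bool, ∃ T : DecisionTree N, ∀ x, T.eval x = f (Function.update x a b) := by
        intro b
        refine ih (fun x => f (Function.update x a b)) fun x y hxy => hf _ _ fun i hi => ?_
        by_cases hia : i = a
        · subst hia; simp
        · simpa [hia] using hxy i ((Finset.mem_insert.1 hi).resolve_left hia)
      choose T hT using h
      refine ⟨.query a T, fun x => ?_⟩
      simp [DecisionTree.eval, hT]
  exact key Finset.univ f fun x y h => congrArg f (funext fun i => h i (Finset.mem_univ i))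

/-- The deterministic query complexity `D(f)` of a total Boolean function: the minimal depth of a
decision tree that computes `f`. -/
noncomputable def queryComplexity {N : ℕ} (f : (Fin N → Bool) → Bool) : ℕ :=
  sInf {d | ∃ T : DecisionTree N, (∀ x, T.eval x = f x) ∧ T.depth = d}

/-- The deterministic query complexity `D(g)` of a partial Boolean function `g : Δ → {0,1}`: the
minimum of `D(f)` over all total Boolean functions `f` that extend `g`. -/
noncomputable def partialQueryComplexity {N : ℕ} {Δ : Set (Fin N → Bool)} (g : Δ → Bool) : ℕ :=
  sInf {d | ∃ f : (Fin N → Bool) → Bool, (∀ x : Δ, f x = g x) ∧ queryComplexity f = d}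

/-! ### The AMPC model -/

/-- Keys: the input indices, the key `ANSWER`, and further keys from an arbitrary set `κ`. -/
inductive Key (N : ℕ) (κ : Type*) where
  | input (i : Fin N)
  | answer
  | other (k : κ)

/-- Values: the bits, and further values from an arbitrary set `ν`. -/
inductive Value (ν : Type*) where
  | bit (b : Bool)
  | other (v : ν)

/-- The content of a distributed data store: a multiset of key-value pairs. -/
abbrev DDS (N : ℕ) (κ ν : Type*) := Multiset (Key N κ × Value ν)

open Classical in
/-- The response to a query for the key `k`: the multiset of all values stored under `k`. -/
noncomputable def DDS.lookup {N : ℕ} {κ ν : Type*} (D : DDS N κ ν) (k : Key N κ) :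
    Multiset (Value ν) :=
  (Multiset.filter (fun p => p.1 = k) D).map Prod.snd

/-- The initial store `D_0`, which holds the `N` pairs `(i, x_i)`. -/
def initialStore {N : ℕ} (κ ν : Type*) (x : Fin N → Bool) : DDS N κ ν :=
  (Finset.univ : Finset (Fin N)).val.map fun i => (Key.input i, Value.bit (x i))

/-- What one machine does in one round: it adaptively queries keys of the previous store, and at the
end it writes a multiset of key-value pairs. -/
inductive Program (N : ℕ) (κ : Type*) (ν : Type*) where
  | write (out : DDS N κ ν)
  | query (k : Key N κ) (next : Multiset (Value ν) → Program N κ ν)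

namespace Program

variable {N : ℕ} {κ ν : Type*}

/-- The total number of values in all responses plus the number of queries with an empty response,
when the program runs on the store `D`: a query costs the size of its response, or `1` if that is
empty. -/
noncomputable def readCost (D : DDS N κ ν) : Program N κ ν → ℕ
  | write _ => 0
  | query k next =>
      max 1 (D.lookup k).card + readCost D (next (D.lookup k))

/-- The pairs at the end of the path that the program follows on the store `D`. -/
noncomputable def output (D : DDS N κ ν) : Program N κ ν → DDS N κ ν
  | write out => out
  | query k next => output D (next (D.lookup k))

/-- The pairs written by a machine with I/O capacity `S`: if its read cost exceeds `S`, the machine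
is stopped and writes nothing. -/
noncomputable def writes (S : ℕ) (D : DDS N κ ν) (P : Program N κ ν) : DDS N κ ν :=
  if P.readCost D ≤ S then P.output D else 0

end Program

/-- A deterministic AMPC algorithm on `N` input bits with set of machines `M`: `A r v` is the program
of machine `v` in the `(r + 1)`-st round. -/
abbrev Algorithm (N : ℕ) (κ ν M : Type*) := ℕ → M → Program N κ ν

namespace Algorithm

variable {N : ℕ} {κ ν M : Type*} [Fintype M]

/-- The store `D_r` during the computation with I/O capacity `S` on the input `x`. -/
noncomputable def store (S : ℕ) (A : Algorithm N κ ν M) (x : Fin N → Bool) : ℕ → DDS N κ ν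
  | 0 => initialStore κ ν x
  | r + 1 => ∑ v : M, (A r v).writes S (store S A x r)

/-- `A` computes the partial Boolean function `g : Δ → {0,1}` in `R` rounds with I/O capacity `S`. -/
structure ComputesIn (S R : ℕ) (A : Algorithm N κ ν M) {Δ : Set (Fin N → Bool)} (g : Δ → Bool) :
    Prop where
  /-- On valid inputs, no machine ever exceeds its capacity when reading. -/
  read_le : ∀ x ∈ Δ, ∀ r < R, ∀ v : M, (A r v).readCost (store S A x r) ≤ S
  /-- On valid inputs, every machine writes at most `S` pairs in every round. -/
  write_le : ∀ x ∈ Δ, ∀ r < R, ∀ v : M, ((A r v).writes S (store S A x r)).card ≤ S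
  /-- On all inputs, valid or not, at most `S` values are written under any key in any round. -/
  key_le : ∀ (x : Fin N → Bool), ∀ r < R, ∀ k : Key N κ,
    ((store S A x (r + 1)).lookup k).card ≤ S
  /-- On a valid input `x`, the final store consists of the single pair `(ANSWER, g(x))`. -/
  answer : ∀ x : Δ, store S A x R = {(Key.answer, Value.bit (g x))}

end Algorithm

end AMPC

/-! The proof is the polynomial method. Claim: for every key and multiset, the indicator that round
`r` stores exactly this multiset under this key has real degree at most `S ^ (2 * r)` on the whole
cube. Each round multiplies the degree by at most `S ^ 2`. One factor `S` comes from reading: a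
machine that is not stopped makes at most `S` queries, so what it writes is a sum, over its possible
transcripts, of products of at most `S` old indicators (`Program.readCost_ite_mem_degreeLE`).
Summing over machines is linear, so multiplicities under a key cost no further degree. The other
factor `S` comes from interpolation: at most `S` values lie under a key, so `S` factors, each affine
in the multiplicities and the size, single out one multiset (`multiset_ite_mem_degreeLE`).

Reading off whether the final answer is `1` thus gives a total extension of `g` of degree `d ≤ S ^
(2 * R)`. A Boolean function of degree `d` has block sensitivity at most `d ^ 2` by Markov's
inequality, and decision tree depth at most block sensitivity times degree, hence at most `d ^ 3`
(`queryComplexity_le_cube`). This gives `S ^ (6 * R)`. -/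

namespace AMPC

open Polynomial

/-! ### The real degree of functions on the Boolean cube -/

section Degree

variable {ι κ : Type*}

/-- The multilinear monomial `∏ i ∈ s, x i` as a function on the Boolean cube. -/
def cubeMonomial (s : Finset ι) (x : ι → Bool) : ℝ :=
  ∏ i ∈ s, if x i then 1 else 0

/-- The functions on the Boolean cube that are represented by a real polynomial of degree at most
`d`. -/
def degreeLE (ι : Type*) (d : ℕ) : Submodule ℝ ((ι → Bool) → ℝ) :=
  Submodule.span ℝ (cubeMonomial '' {s : Finset ι | s.card ≤ d})

theorem cubeMonomial_mem_degreeLE {s : Finset ι} {d : ℕ} (h : s.card ≤ d) :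
    cubeMonomial s ∈ degreeLE ι d :=
  Submodule.subset_span ⟨s, h, rfl⟩

theorem degreeLE_mono {d e : ℕ} (h : d ≤ e) : degreeLE ι d ≤ degreeLE ι e :=
  Submodule.span_mono (Set.image_mono fun _ hs => le_trans hs h)

theorem const_mem_degreeLE (c : ℝ) (d : ℕ) : (fun _ => c) ∈ degreeLE ι d := by
  have h := (degreeLE ι d).smul_mem c (cubeMonomial_mem_degreeLE (s := ∅) (by simp))
  convert h using 1
  ext x
  simp [cubeMonomial]

theorem coord_mem_degreeLE (i : ι) :
    (fun x : ι → Bool => if x i then (1 : ℝ) else 0) ∈ degreeLE ι 1 := by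
  convert cubeMonomial_mem_degreeLE (s := {i}) (d := 1) (by simp) using 1
  ext x
  simp [cubeMonomial]

theorem cubeMonomial_mul [DecidableEq ι] (s t : Finset ι) :
    cubeMonomial s * cubeMonomial t = cubeMonomial (s ∪ t) := by
  ext x
  simp only [cubeMonomial, Pi.mul_apply, Finset.prod_ite_zero, Finset.prod_const_one,
    Finset.mem_union]
  split_ifs <;> grind

theorem mul_mem_degreeLE {f g : (ι → Bool) → ℝ} {d e : ℕ} (hf : f ∈ degreeLE ι d)
    (hg : g ∈ degreeLE ι e) : f * g ∈ degreeLE ι (d + e) := by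
  classical
  refine Submodule.span_induction₂ (p := fun f g _ _ => f * g ∈ degreeLE ι (d + e))
    ?_ ?_ ?_ ?_ ?_ ?_ ?_ hf hg
  · rintro _ _ ⟨s, hs, rfl⟩ ⟨t, ht, rfl⟩
    rw [cubeMonomial_mul]
    exact cubeMonomial_mem_degreeLE ((Finset.card_union_le s t).trans (add_le_add hs ht))
  · intro g _; simp
  · intro f _; simp
  · intro f₁ f₂ g _ _ _ h₁ h₂
    rw [add_mul]
    exact Submodule.add_mem _ h₁ h₂
  · intro f g₁ g₂ _ _ _ h₁ h₂
    rw [mul_add]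
    exact Submodule.add_mem _ h₁ h₂
  · intro c f g _ _ h
    rw [smul_mul_assoc]
    exact Submodule.smul_mem _ c h
  · intro c f g _ _ h
    rw [mul_smul_comm]
    exact Submodule.smul_mem _ c h

theorem prod_mem_degreeLE {α : Type*} (s : Finset α) (f : α → (ι → Bool) → ℝ) (d : α → ℕ)
    (h : ∀ a ∈ s, f a ∈ degreeLE ι (d a)) :
    (fun x => ∏ a ∈ s, f a x) ∈ degreeLE ι (∑ a ∈ s, d a) := by
  classical
  induction s using Finset.induction_on with
  | empty => simpa using const_mem_degreeLE 1 0
  | insert a s ha ih =>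
    simp only [Finset.prod_insert ha, Finset.sum_insert ha]
    exact mul_mem_degreeLE (h a (Finset.mem_insert_self a s))
      (ih fun b hb => h b (Finset.mem_insert_of_mem hb))

/-- Substituting functions of degree at most `1` does not raise the degree. -/
theorem comp_mem_degreeLE {f : (ι → Bool) → ℝ} {d : ℕ} (hf : f ∈ degreeLE ι d)
    (φ : (κ → Bool) → ι → Bool)
    (hφ : ∀ i, (fun y => if φ y i then (1 : ℝ) else 0) ∈ degreeLE κ 1) :
    (fun y => f (φ y)) ∈ degreeLE κ d := by
  induction hf using Submodule.span_induction with
  | mem f hf =>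
    obtain ⟨s, hs, rfl⟩ := hf
    have h := prod_mem_degreeLE s (fun i y => if φ y i then (1 : ℝ) else 0) (fun _ => 1)
      fun i _ => hφ i
    exact degreeLE_mono (by simpa using hs) h
  | zero => exact const_mem_degreeLE 0 d
  | add f g _ _ hf hg => exact Submodule.add_mem _ hf hg
  | smul c f _ hf => exact Submodule.smul_mem _ c hf

variable [Fintype ι]

theorem exists_coeff_of_mem_degreeLE {f : (ι → Bool) → ℝ} {d : ℕ} (hf : f ∈ degreeLE ι d) :
    ∃ c : Finset ι → ℝ, (∀ s, d < s.card → c s = 0) ∧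
      ∀ x, f x = ∑ s, c s * cubeMonomial s x := by
  classical
  induction hf using Submodule.span_induction with
  | mem f hf =>
    obtain ⟨t, ht, rfl⟩ := hf
    refine ⟨fun s => if s = t then 1 else 0, fun s hs => if_neg ?_, fun x => by simp⟩
    rintro rfl
    exact absurd ht (by simpa using hs)
  | zero => exact ⟨0, by simp, by simp⟩
  | add f g _ _ hf hg =>
    obtain ⟨a, ha, hf⟩ := hf
    obtain ⟨b, hb, hg⟩ := hg
    exact ⟨a + b, fun s hs => by simp [ha s hs, hb s hs], fun x => by
      simp [hf, hg, add_mul, Finset.sum_add_distrib]⟩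
  | smul r f _ hf =>
    obtain ⟨a, ha, hf⟩ := hf
    exact ⟨r • a, fun s hs => by simp [ha s hs], fun x => by
      simp [hf, mul_assoc, Finset.mul_sum]⟩

/-! ### Sensitivity of low-degree functions -/

/-- The expectation of a monomial when the bits are independently `1` with probability `t`. -/
theorem sum_cubeMonomial_mul_prod [DecidableEq ι] (s : Finset ι) (t : ℝ) :
    ∑ y : ι → Bool, cubeMonomial s y * ∏ i, (if y i then t else 1 - t) = t ^ s.card := by
  have h : ∀ y : ι → Bool, cubeMonomial s y * ∏ i, (if y i then t else 1 - t) =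
      ∏ i, ((if i ∈ s then (if y i then 1 else 0) else 1) * (if y i then t else 1 - t)) := by
    intro y
    rw [Finset.prod_mul_distrib, Finset.prod_ite_mem, Finset.univ_inter, cubeMonomial]
  simp only [h]
  rw [← Fintype.piFinset_univ, ← Finset.prod_univ_sum (fun _ => Finset.univ)
    (fun i b => (if i ∈ s then (if b = true then 1 else 0) else 1) *
      (if b = true then t else 1 - t))]
  have h' : ∀ i, ∑ b : Bool, (if i ∈ s then (if b = true then (1 : ℝ) else 0) else 1) *
      (if b = true then t else 1 - t) = if i ∈ s then t else 1 := by
    intro i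
    by_cases hi : i ∈ s <;> simp [hi]
  simp only [h', Finset.prod_ite_mem, Finset.univ_inter, Finset.prod_const]

/-- Markov's inequality at an endpoint of the unit interval. -/
theorem derivative_eval_zero_le {Q : ℝ[X]} {d : ℕ} (hd : Q.degree ≤ d)
    (hQ : ∀ t ∈ Set.Icc (0 : ℝ) 1, Q.eval t ∈ Set.Icc (0 : ℝ) 1) :
    (derivative Q).eval 0 ≤ (d : ℝ) ^ 2 := by
  -- The affine changes of variable carry `[0, 1]` to `[-1, 1]` and send `0` to `1`. The two sign
  -- changes and the factors `2` and `1 / 2` cancel, so `P'(1) = Q'(0)`, which is at most `T_d'(1) =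
  -- d ^ 2`.
  set L : ℝ[X] := C (1 / 2) * (1 - X) with hL
  set P : ℝ[X] := 1 - C 2 * Q.comp L with hP
  have hLdeg : L.natDegree ≤ 1 := by rw [hL]; compute_degree
  have hQd : Q.natDegree ≤ d := natDegree_le_of_degree_le hd
  have hPdeg : P.degree ≤ d := by
    refine degree_le_of_natDegree_le ?_
    refine (natDegree_sub_le _ _).trans (max_le (by simp) ?_)
    refine (natDegree_C_mul_le _ _).trans ?_
    rw [natDegree_comp]
    exact (Nat.mul_le_mul hQd hLdeg).trans (by simp)
  have hbnd : ∀ x ∈ Set.Icc (-1 : ℝ) 1, |P.eval x| ≤ 1 := by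
    intro x hx
    have h := hQ (1 / 2 * (1 - x)) ⟨by linarith [hx.2], by linarith [hx.1]⟩
    have he : P.eval x = 1 - 2 * Q.eval (1 / 2 * (1 - x)) := by simp [hP, hL]
    rw [he, abs_le]
    constructor <;> linarith [h.1, h.2]
  have key := Polynomial.Chebyshev.eval_iterate_derivative_le_of_forall_abs_le_one
    (k := 1) le_rfl hPdeg hbnd
  have h1 : (derivative P).eval 1 = (derivative Q).eval 0 := by
    simp [hP, hL, derivative_comp]
  simp only [Function.iterate_one, h1, Polynomial.Chebyshev.T_derivative_eq_U, eval_mul,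
    Polynomial.Chebyshev.U_eval_one] at key
  refine key.trans (le_of_eq ?_)
  simp [sq]

/-- Let `Q t` be the expectation of `h` under independent bits of bias `t`. It is a polynomial of
degree at most `d` that maps `[0, 1]` to itself, and `Q'(0)` is the sum of the linear coefficients
of `h`, each equal to `1`. Markov's inequality bounds this slope by `d ^ 2`. -/
theorem card_le_sq_of_unit_values [DecidableEq ι] {h : (ι → Bool) → ℝ} {d : ℕ}
    (hd : h ∈ degreeLE ι d) (hbd : ∀ y, h y ∈ Set.Icc (0 : ℝ) 1) (h0 : h (fun _ => false) = 0)
    (h1 : ∀ j, h (fun i => decide (i = j)) = 1) : Fintype.card ι ≤ d ^ 2 := by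
  obtain ⟨c, hc, hsum⟩ := exists_coeff_of_mem_degreeLE hd
  set Q : ℝ[X] := ∑ s : Finset ι, C (c s) * X ^ s.card with hQ
  have heval : ∀ t, Q.eval t = ∑ y : ι → Bool, h y * ∏ i, (if y i then t else 1 - t) := by
    intro t
    simp only [hsum, Finset.sum_mul, mul_assoc]
    rw [Finset.sum_comm]
    simp only [← Finset.mul_sum, sum_cubeMonomial_mul_prod]
    simp [hQ, eval_finsetSum]
  have hdeg : Q.degree ≤ d := by
    refine (degree_sum_le _ _).trans (Finset.sup_le fun s _ => ?_)
    by_cases hs : d < s.card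
    · simp [hc s hs]
    · exact (degree_C_mul_X_pow_le _ _).trans (by exact_mod_cast not_lt.1 hs)
  have hbound : ∀ t ∈ Set.Icc (0 : ℝ) 1, Q.eval t ∈ Set.Icc (0 : ℝ) 1 := by
    intro t ht
    have hw : ∀ y : ι → Bool, 0 ≤ ∏ i, (if y i then t else 1 - t) := fun y =>
      Finset.prod_nonneg fun i _ => by split_ifs <;> linarith [ht.1, ht.2]
    rw [heval]
    refine ⟨Finset.sum_nonneg fun y _ => mul_nonneg (hbd y).1 (hw y), ?_⟩
    have htot := sum_cubeMonomial_mul_prod (∅ : Finset ι) t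
    rw [Finset.card_empty, pow_zero] at htot
    refine le_of_le_of_eq ?_ htot
    refine Finset.sum_le_sum fun y _ => mul_le_mul_of_nonneg_right ?_ (hw y)
    simpa [cubeMonomial] using (hbd y).2
  have hempty : c ∅ = 0 := by
    rw [hsum, Finset.sum_eq_single ∅] at h0
    · simpa [cubeMonomial] using h0
    · intro s _ hs
      obtain ⟨i, hi⟩ := Finset.nonempty_iff_ne_empty.2 hs
      simp [cubeMonomial, Finset.prod_eq_zero hi]
    · simp
  have hsingle : ∀ j, c {j} = 1 := by
    intro j
    have h := h1 j
    rw [hsum, Finset.sum_eq_single {j}] at h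
    · simpa [cubeMonomial] using h
    · intro s _ hs
      by_cases hs' : s = ∅
      · simp [hs', hempty]
      obtain ⟨i, hi, hij⟩ : ∃ i ∈ s, i ≠ j := by
        by_contra! hcon
        exact hs (Finset.eq_singleton_iff_nonempty_unique_mem.2
          ⟨Finset.nonempty_iff_ne_empty.2 hs', hcon⟩)
      simp [cubeMonomial, Finset.prod_eq_zero hi, hij]
    · simp
  have hder : (derivative Q).eval 0 = Fintype.card ι := by
    have hterm : ∀ s : Finset ι, (derivative (C (c s) * X ^ s.card)).eval 0 =
        ∑ j : ι, if s = {j} then (1 : ℝ) else 0 := by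
      intro s
      rcases Nat.lt_trichotomy s.card 1 with hs | hs | hs
      · have hs' : s = ∅ := by simpa using hs
        subst hs'
        simp
      · obtain ⟨j, rfl⟩ := Finset.card_eq_one.1 hs
        simp [hsingle]
      · have hne : ∀ j, s ≠ {j} := by
          rintro j rfl
          simp at hs
        simp [hne, derivative_X_pow, show s.card - 1 ≠ 0 by omega]
    rw [hQ, derivative_sum, eval_finsetSum, Finset.sum_congr rfl fun s _ => hterm s,
      Finset.sum_comm]
    simp
  have := derivative_eval_zero_le hdeg hbound
  rw [hder] at this
  exact_mod_cast this

end Degree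

/-! ### Query complexity is at most the cube of the degree -/

section BooleanComplexity

variable {ι : Type*}

/-- The input `x` with the bits in the block labelled `j` flipped. -/
def flipBlock (l : ι → ℕ) (j : ℕ) (x : ι → Bool) : ι → Bool :=
  fun i => if l i = j then !x i else x i

/-- Labels encode disjoint blocks. Giving each block one switch variable turns sensitive blocks at
`x` into sensitive single bits at the origin, without raising the degree. -/
theorem sensitive_blocks_le_sq {f : (ι → Bool) → Bool} {d : ℕ}
    (hf : (fun x => if f x then (1 : ℝ) else 0) ∈ degreeLE ι d) {x : ι → Bool} {l : ι → ℕ} {k : ℕ}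
    (h : ∀ j < k, f (flipBlock l j x) ≠ f x) : k ≤ d ^ 2 := by
  let φ : (Fin k → Bool) → ι → Bool := fun y i =>
    if hi : l i < k then xor (x i) (y ⟨l i, hi⟩) else x i
  have hφ : ∀ i, (fun y => if φ y i then (1 : ℝ) else 0) ∈ degreeLE (Fin k) 1 := by
    intro i
    by_cases hi : l i < k
    · cases hx : x i
      · simpa [φ, hi, hx] using coord_mem_degreeLE (⟨l i, hi⟩ : Fin k)
      · have := Submodule.sub_mem _ (const_mem_degreeLE 1 1)
          (coord_mem_degreeLE (⟨l i, hi⟩ : Fin k))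
        convert this using 1
        ext y
        cases hy : y ⟨l i, hi⟩ <;> simp [φ, hi, hx, hy]
    · simpa [φ, hi] using const_mem_degreeLE _ 1
  have hφ0 : φ (fun _ => false) = x := by
    ext i
    simp [φ]
  have hφ1 : ∀ j : Fin k, φ (fun i => decide (i = j)) = flipBlock l j x := by
    intro j
    ext i
    by_cases hi : l i < k
    · by_cases hj : l i = j <;> simp [φ, flipBlock, hi, hj, Fin.ext_iff]
    · have : l i ≠ j := by omega
      simp [φ, flipBlock, hi, this]
  -- Comparing with `f x` normalizes the value at the origin to `0`; if `f x` is true this is the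
  -- complement, of the same degree.
  have hdeg : (fun y => if f (φ y) ≠ f x then (1 : ℝ) else 0) ∈ degreeLE (Fin k) d := by
    have hcomp := comp_mem_degreeLE hf φ hφ
    cases hx : f x
    · simpa [hx] using hcomp
    · convert Submodule.sub_mem _ (const_mem_degreeLE 1 d) hcomp using 1
      ext y
      cases hy : f (φ y) <;> simp [hy]
  have := card_le_sq_of_unit_values hdeg (fun y => by split_ifs <;> simp) (by simp [hφ0])
    (fun j => by simpa [hφ1] using h j j.2)
  simpa using this

/-- For `a ∈ s \ w`, the terms of `u` and `insert a u` cancel, since the monomial does not see `a`.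
-/
theorem sum_powerset_neg_one_pow_mul_cubeMonomial_eq_zero [DecidableEq ι] {s w : Finset ι}
    (hsw : ¬ s ⊆ w) (z : ι → Bool) :
    ∑ u ∈ s.powerset, (-1 : ℝ) ^ u.card *
      cubeMonomial w (fun i => if i ∈ s then decide (i ∈ u) else z i) = 0 := by
  obtain ⟨a, has, haw⟩ := Finset.not_subset.1 hsw
  obtain ⟨t, hat, rfl⟩ : ∃ t, a ∉ t ∧ insert a t = s :=
    ⟨s.erase a, Finset.notMem_erase a s, Finset.insert_erase has⟩
  rw [Finset.sum_powerset_insert hat, ← Finset.sum_add_distrib]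
  refine Finset.sum_eq_zero fun u hu => ?_
  have hau : a ∉ u := fun h => hat (Finset.mem_powerset.1 hu h)
  have : cubeMonomial w (fun i => if i ∈ insert a t then decide (i ∈ insert a u) else z i) =
      cubeMonomial w (fun i => if i ∈ insert a t then decide (i ∈ u) else z i) := by
    refine Finset.prod_congr rfl fun i hi => ?_
    have : i ≠ a := fun h => haw (h ▸ hi)
    simp [this]
  rw [this, Finset.card_insert_of_notMem hau]
  ring

variable [Fintype ι] in
/-- The variables of a monomial of maximal degree of a nonconstant function form a block on which
the function remains nonconstant, however the other variables are fixed. -/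
theorem exists_nonconstant_block {f : (ι → Bool) → ℝ} {d : ℕ} (hf : f ∈ degreeLE ι d)
    (hne : ∃ x y, f x ≠ f y) :
    ∃ s : Finset ι, s.card ≤ d ∧ ∀ z, ∃ y, (∀ i ∉ s, y i = z i) ∧ f y ≠ f z := by
  classical
  obtain ⟨c, hc, hsum⟩ := exists_coeff_of_mem_degreeLE hf
  have hex : ∃ s, c s ≠ 0 := by
    by_contra! h
    obtain ⟨x, y, hxy⟩ := hne
    exact hxy (by simp [hsum, h])
  obtain ⟨s, hs, hmax⟩ := Finset.exists_max_image (Finset.univ.filter fun s => c s ≠ 0)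
    Finset.card (by simpa [Finset.Nonempty] using hex)
  simp only [Finset.mem_filter, Finset.mem_univ, true_and] at hs hmax
  have hs0 : s.Nonempty := by
    rw [Finset.nonempty_iff_ne_empty]
    rintro rfl
    have h0 : ∀ w, w ≠ ∅ → c w = 0 := by
      intro w hw
      by_contra hcw
      exact hw (by simpa using hmax w hcw)
    have hconst : ∀ x, f x = c ∅ := by
      intro x
      rw [hsum, Finset.sum_eq_single ∅]
      · simp [cubeMonomial]
      · intro w _ hw
        simp [h0 w hw]
      · simp
    obtain ⟨x, y, hxy⟩ := hne
    exact hxy (by rw [hconst, hconst])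
  refine ⟨s, not_lt.1 fun h => hs (hc s h), fun z => ?_⟩
  by_contra! hcon
  -- If `f` were constant on this subcube, its alternating sum would vanish. But by maximality of
  -- `s` no other monomial of `f` contains `s`, so the sum equals `± c s ≠ 0`.
  have hzero : ∑ u ∈ s.powerset, (-1 : ℝ) ^ u.card *
      f (fun i => if i ∈ s then decide (i ∈ u) else z i) = 0 := by
    rw [Finset.sum_congr rfl fun u _ => by rw [hcon _ fun i hi => if_neg hi], ← Finset.sum_mul]
    have := Finset.sum_powerset_neg_one_pow_card_of_nonempty hs0
    have h' : ∑ u ∈ s.powerset, (-1 : ℝ) ^ u.card = 0 := by exact_mod_cast this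
    rw [h', zero_mul]
  simp only [hsum, Finset.mul_sum] at hzero
  rw [Finset.sum_comm, Finset.sum_eq_single s] at hzero
  · rw [Finset.sum_eq_single s] at hzero
    · have h1 : cubeMonomial s (fun i => if i ∈ s then decide (i ∈ s) else z i) = 1 :=
        Finset.prod_eq_one fun i hi => by simp [hi]
      rw [h1] at hzero
      simp [hs] at hzero
    · intro u hu hus
      obtain ⟨i, hi, hiu⟩ : ∃ i ∈ s, i ∉ u := by
        by_contra! h
        exact hus (Finset.Subset.antisymm (Finset.mem_powerset.1 hu) h)
      have : cubeMonomial s (fun i => if i ∈ s then decide (i ∈ u) else z i) = 0 :=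
        Finset.prod_eq_zero hi (by simp [hi, hiu])
      simp [this]
    · simp
  · intro w _ hws
    by_cases hcw : c w = 0
    · simp [hcw]
    have hsw : ¬ s ⊆ w := fun h => hws (Finset.eq_of_subset_of_card_le h (hmax w hcw)).symm
    have := sum_powerset_neg_one_pow_mul_cubeMonomial_eq_zero hsw z
    rw [← mul_zero (c w), ← this, Finset.mul_sum]
    exact Finset.sum_congr rfl fun u _ => by ring
  · simp

end BooleanComplexity

/-! ### Decision trees from degree and block sensitivity -/

section Tree

variable {N : ℕ}

/-- A decision tree that first queries all variables in `s`. -/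
theorem exists_tree_of_restrictions (s : Finset (Fin N)) {k : ℕ} (f : (Fin N → Bool) → Bool)
    (h : ∀ ρ : Fin N → Bool, ∃ T : DecisionTree N,
      (∀ x, T.eval x = f (s.piecewise ρ x)) ∧ T.depth ≤ k) :
    ∃ T : DecisionTree N, (∀ x, T.eval x = f x) ∧ T.depth ≤ s.card + k := by
  induction s using Finset.induction_on generalizing f with
  | empty => simpa using h
  | insert a s ha ih =>
    have hb : ∀ b : Bool, ∃ T : DecisionTree N,
        (∀ x, T.eval x = f (Function.update x a b)) ∧ T.depth ≤ s.card + k := by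
      intro b
      refine ih (fun x => f (Function.update x a b)) fun ρ => ?_
      obtain ⟨T, hT, hk⟩ := h (Function.update ρ a b)
      refine ⟨T, fun x => ?_, hk⟩
      rw [hT]
      congr 1
      ext i
      by_cases hi : i = a
      · subst hi; simp
      · by_cases his : i ∈ s <;> simp [hi, his, Finset.piecewise]
    choose T hT hk using hb
    refine ⟨.query a T, fun x => ?_, ?_⟩
    · simp [DecisionTree.eval, hT]
    · rw [Finset.card_insert_of_notMem ha, DecisionTree.depth]
      have := hk true
      have := hk false
      omega

/-- If `f` has degree at most `d` and block sensitivity at most `t`, then it has a decision tree of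
depth at most `t * d`. -/
theorem exists_tree_of_blockSensitivity (t d : ℕ) (f : (Fin N → Bool) → Bool)
    (hf : (fun x => if f x then (1 : ℝ) else 0) ∈ degreeLE (Fin N) d)
    (hbs : ∀ (x : Fin N → Bool) (l : Fin N → ℕ) (k : ℕ),
      (∀ j < k, f (flipBlock l j x) ≠ f x) → k ≤ t) :
    ∃ T : DecisionTree N, (∀ x, T.eval x = f x) ∧ T.depth ≤ t * d := by
  induction t generalizing f with
  | zero =>
    refine ⟨.leaf (f fun _ => false), fun x => ?_, by simp [DecisionTree.depth]⟩
    by_contra hne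
    -- If `f` differs at `x` and at the origin, the support of `x` is a sensitive block there.
    have := hbs (fun _ => false) (fun i => if x i then 0 else 1) 1 fun j hj => by
      obtain rfl : j = 0 := by omega
      have : flipBlock (fun i => if x i then 0 else 1) 0 (fun _ => false) = x := by
        ext i
        cases hx : x i <;> simp [flipBlock, hx]
      rw [this]
      exact fun h => hne h.symm
    omega
  | succ t ih =>
    by_cases hconst : ∃ x y, f x ≠ f y
    swap
    · push Not at hconst
      exact ⟨.leaf (f fun _ => false), fun x => hconst _ _, by simp [DecisionTree.depth]⟩
    obtain ⟨s, hsd, hs⟩ := exists_nonconstant_block hf (by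
      obtain ⟨x, y, hxy⟩ := hconst
      refine ⟨x, y, fun h => hxy ?_⟩
      cases hx : f x <;> cases hy : f y <;> simp [hx, hy] at h ⊢)
    -- Querying `s` costs at most `d`. Every restriction loses one unit of block sensitivity,
    -- because its sensitive blocks can be taken outside `s` and `s` itself always contains one
    -- more.
    obtain ⟨T, hT, hk⟩ := exists_tree_of_restrictions s (k := t * d) f fun ρ => by
      refine ih (fun x => f (s.piecewise ρ x)) ?_ ?_
      · refine comp_mem_degreeLE hf _ fun i => ?_
        by_cases hi : i ∈ s
        · simpa [hi] using const_mem_degreeLE _ 1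
        · simpa [hi] using coord_mem_degreeLE i
      · intro x l k hl
        obtain ⟨y, hyz, hy⟩ := hs (s.piecewise ρ x)
        -- Label `k` marks the extra block, where `y` differs from the base point; `k + 1` marks
        -- unused positions.
        let l' : Fin N → ℕ := fun i =>
          if i ∈ s then (if y i = s.piecewise ρ x i then k + 1 else k)
          else if l i < k then l i else k + 1
        refine Nat.le_of_succ_le_succ (hbs (s.piecewise ρ x) l' (k + 1) fun j hj => ?_)
        rcases Nat.lt_succ_iff_lt_or_eq.1 hj with hj | rfl
        · have : flipBlock l' j (s.piecewise ρ x) = s.piecewise ρ (flipBlock l j x) := by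
            ext i
            by_cases hi : i ∈ s
            · have : l' i ≠ j := by simp only [l', hi, if_true]; split_ifs <;> omega
              simp [flipBlock, hi, this]
            · have : l' i = j ↔ l i = j := by simp only [l', hi, if_false]; split_ifs <;> omega
              simp [flipBlock, hi, this]
          rw [this]
          exact hl j hj
        · have : flipBlock l' j (s.piecewise ρ x) = y := by
            ext i
            by_cases hi : i ∈ s
            · by_cases hyi : y i = s.piecewise ρ x i
              · simp [flipBlock, l', hi, hyi]
              · have : l' i = j := by simp only [l', hi, hyi, if_true, if_false]
                simp only [flipBlock, this, if_true]
                revert hyi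
                cases y i <;> cases s.piecewise ρ x i <;> simp
            · have : l' i ≠ j := by simp only [l', hi, if_false]; split_ifs <;> omega
              simp only [flipBlock, this, if_false, hyz i hi]
          rw [this]
          exact fun h => hy (by rw [h])
    refine ⟨T, hT, hk.trans ?_⟩
    rw [add_mul, one_mul, add_comm]
    exact Nat.add_le_add_left hsd _

theorem queryComplexity_le_cube {f : (Fin N → Bool) → Bool} {d : ℕ}
    (hf : (fun x => if f x then (1 : ℝ) else 0) ∈ degreeLE (Fin N) d) :
    queryComplexity f ≤ d ^ 3 := by
  obtain ⟨T, hT, hk⟩ := exists_tree_of_blockSensitivity (d ^ 2) d f hf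
    fun _ _ _ h => sensitive_blocks_le_sq hf h
  have hle : queryComplexity f ≤ T.depth := Nat.sInf_le ⟨T, hT, rfl⟩
  exact hle.trans (hk.trans (pow_succ d 2).ge)

end Tree

/-! ### The degree of an AMPC computation -/

section Computation

variable {N : ℕ} {κ ν : Type*}

namespace DDS

theorem lookup_add (D E : DDS N κ ν) (k : Key N κ) :
    DDS.lookup (D + E) k = D.lookup k + E.lookup k := by
  simp [DDS.lookup]

theorem lookup_initialStore_input (x : Fin N → Bool) (i : Fin N) :
    DDS.lookup (initialStore κ ν x) (Key.input i) = {Value.bit (x i)} := by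
  classical
  have : Finset.univ.filter (fun j : Fin N => (Key.input j : Key N κ) = Key.input i) = {i} := by
    ext j
    simp
  simp only [DDS.lookup, initialStore, Multiset.filter_map, Multiset.map_map, Function.comp_def]
  have h := congrArg Finset.val this
  simp only [Finset.filter_val, Finset.singleton_val] at h
  convert congrArg (Multiset.map fun j => (Value.bit (x j) : Value ν)) h using 1
  simp

theorem lookup_initialStore_of_ne (x : Fin N → Bool) {k : Key N κ} (hk : ∀ i, Key.input i ≠ k) :
    DDS.lookup (initialStore κ ν x) k = 0 := by
  simp [DDS.lookup, initialStore, hk]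

end DDS

open Classical in
/-- The output of a machine with read budget `T` on stores whose lookups have degree at most `d`. -/
theorem Program.readCost_ite_mem_degreeLE {D : (Fin N → Bool) → DDS N κ ν} {d : ℕ}
    (hD : ∀ k m, (fun x => if (D x).lookup k = m then (1 : ℝ) else 0) ∈ degreeLE (Fin N) d)
    (φ : DDS N κ ν → ℝ) (P : Program N κ ν) (T : ℕ) :
    (fun x => if P.readCost (D x) ≤ T then φ (P.output (D x)) else 0) ∈
      degreeLE (Fin N) (T * d) := by
  induction P generalizing T with
  | write out => simpa [Program.readCost, Program.output] using const_mem_degreeLE _ _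
  | query k next ih =>
    -- Split by the response to the first query; only finitely many occur, as the cube is finite.
    have heq : (fun x => if (Program.query k next).readCost (D x) ≤ T then
        φ ((Program.query k next).output (D x)) else 0) =
        ∑ m ∈ Finset.univ.image fun x => (D x).lookup k, fun x =>
          (if (D x).lookup k = m then (1 : ℝ) else 0) *
            if max 1 m.card + (next m).readCost (D x) ≤ T then φ ((next m).output (D x)) else 0 := by
      ext x
      rw [Finset.sum_apply, Finset.sum_eq_single ((D x).lookup k)]
      · simp only [Program.readCost, Program.output, if_true, one_mul]
        congr
      · intro m _ hm
        simp [hm.symm]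
      · intro h
        exact absurd (Finset.mem_image_of_mem _ (Finset.mem_univ x)) h
    rw [heq]
    refine Submodule.sum_mem _ fun m _ => ?_
    by_cases hm : max 1 m.card ≤ T
    · have h := mul_mem_degreeLE (hD k m) (ih m (T - max 1 m.card))
      have hdeg : d + (T - max 1 m.card) * d ≤ T * d := by
        -- Even an empty response uses a unit of budget, which pays for the factor of degree `d`.
        have h1 : 1 + (T - max 1 m.card) ≤ T := by omega
        calc d + (T - max 1 m.card) * d = (1 + (T - max 1 m.card)) * d := by ring
          _ ≤ T * d := Nat.mul_le_mul_right d h1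
      refine degreeLE_mono hdeg ?_
      convert h using 1
      ext x
      simp only [Pi.mul_apply, Nat.le_sub_iff_add_le' hm]
    · have : ∀ c, ¬ max 1 m.card + c ≤ T := fun c hc => hm (le_trans (Nat.le_add_right _ _) hc)
      simpa [this] using const_mem_degreeLE 0 _

/-- The indicator of a multiset among all multisets of at most `S` elements, as a product of `S`
factors of degree one in the multiplicities. -/
theorem multiset_prod_count_mul_prod_card_eq_ite {α : Type*} [DecidableEq α] {S : ℕ}
    {L m : Multiset α} (hL : L.card ≤ S) :
    (∏ a ∈ m.toFinset, ∏ i ∈ Finset.range (m.count a),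
        (((L.count a : ℝ) - i) * ((m.count a : ℝ) - i)⁻¹)) *
      ∏ j ∈ Finset.Ioc m.card S, (((j : ℝ) - L.card) * ((j : ℝ) - m.card)⁻¹) =
    if L = m then 1 else 0 := by
  split_ifs with h
  · subst h
    have h1 : ∀ a ∈ L.toFinset, ∏ i ∈ Finset.range (L.count a),
        (((L.count a : ℝ) - i) * ((L.count a : ℝ) - i)⁻¹) = 1 := fun a _ =>
      Finset.prod_eq_one fun i hi => mul_inv_cancel₀ <| sub_ne_zero.2 <| by
        exact_mod_cast (Finset.mem_range.1 hi).ne'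
    rw [Finset.prod_eq_one h1, one_mul]
    refine Finset.prod_eq_one fun j hj => mul_inv_cancel₀ <| sub_ne_zero.2 ?_
    exact_mod_cast (Finset.mem_Ioc.1 hj).1.ne'
  -- If `m ≤ L` fails, some element is too rare in `L` and its factor with `i = L.count a` vanishes.
  -- Otherwise `L` is strictly larger than `m`, and the factor with `j = L.card` vanishes.
  · by_cases hle : m ≤ L
    · have hcard : m.card < L.card := Multiset.card_lt_card (lt_of_le_of_ne hle (Ne.symm h))
      rw [Finset.prod_eq_zero (Finset.mem_Ioc.2 ⟨hcard, hL⟩) (by simp), mul_zero]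
    · rw [Multiset.le_iff_count] at hle
      push Not at hle
      obtain ⟨a, ha⟩ := hle
      have ham : a ∈ m.toFinset :=
        Multiset.mem_toFinset.2 (Multiset.count_pos.1 (lt_of_le_of_lt (Nat.zero_le _) ha))
      rw [Finset.prod_eq_zero ham (Finset.prod_eq_zero (Finset.mem_range.2 ha) (by simp)),
        zero_mul]

-- The interpolation product has `m.card + (S - m.card) = S` factors, each of degree at most `e`.
open Classical in
theorem multiset_ite_mem_degreeLE {α : Type*} {S e : ℕ} {L : (Fin N → Bool) → Multiset α}
    (hL : ∀ x, (L x).card ≤ S)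
    (hcount : ∀ a, (fun x => ((L x).count a : ℝ)) ∈ degreeLE (Fin N) e)
    (hcard : (fun x => ((L x).card : ℝ)) ∈ degreeLE (Fin N) e) (m : Multiset α) :
    (fun x => if L x = m then (1 : ℝ) else 0) ∈ degreeLE (Fin N) (S * e) := by
  by_cases hm : m.card ≤ S
  · simp only [← multiset_prod_count_mul_prod_card_eq_ite (hL _)]
    have h1 := prod_mem_degreeLE m.toFinset (fun a x => ∏ i ∈ Finset.range (m.count a),
        ((((L x).count a : ℝ) - i) * ((m.count a : ℝ) - i)⁻¹)) (fun a => m.count a * e)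
      fun a _ => by
        have := prod_mem_degreeLE (Finset.range (m.count a))
          (fun i x => (((L x).count a : ℝ) - i) * ((m.count a : ℝ) - i)⁻¹) (fun _ => e)
          fun i _ => by
            have := Submodule.smul_mem _ ((m.count a : ℝ) - i)⁻¹
              (Submodule.sub_mem _ (hcount a) (const_mem_degreeLE (i : ℝ) e))
            convert this using 1
            ext x
            simp [mul_comm]
        simpa using this
    have h2 := prod_mem_degreeLE (Finset.Ioc m.card S)
      (fun j x => ((j : ℝ) - (L x).card) * ((j : ℝ) - m.card)⁻¹) (fun _ => e) fun j _ => by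
        have := Submodule.smul_mem _ ((j : ℝ) - m.card)⁻¹
          (Submodule.sub_mem _ (const_mem_degreeLE (j : ℝ) e) hcard)
        convert this using 1
        ext x
        simp [mul_comm]
    have h := mul_mem_degreeLE h1 h2
    rw [← Finset.sum_mul, Multiset.toFinset_sum_count_eq, Finset.sum_const, Nat.card_Ioc,
      smul_eq_mul, ← add_mul, Nat.add_sub_cancel' hm] at h
    exact h
  · have : ∀ x, L x ≠ m := fun x h => hm (h ▸ hL x)
    simpa [this] using const_mem_degreeLE 0 _

variable {M : Type*} [Fintype M]

open Classical in
theorem Algorithm.lookup_store_ite_mem_degreeLE {S R : ℕ} {A : Algorithm N κ ν M}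
    (hkey : ∀ (x : Fin N → Bool), ∀ r < R, ∀ k : Key N κ,
      ((Algorithm.store S A x (r + 1)).lookup k).card ≤ S)
    {r : ℕ} (hr : r ≤ R) (k : Key N κ) (m : Multiset (Value ν)) :
    (fun x => if (Algorithm.store S A x r).lookup k = m then (1 : ℝ) else 0) ∈
      degreeLE (Fin N) (S ^ (2 * r)) := by
  induction r generalizing k m with
  | zero =>
    simp only [Algorithm.store, mul_zero, pow_zero]
    by_cases hk : ∃ i, Key.input i = k
    · obtain ⟨i, rfl⟩ := hk
      have h1 := coord_mem_degreeLE i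
      have h0 := Submodule.sub_mem _ (const_mem_degreeLE 1 1) h1
      have h := Submodule.add_mem _
        (Submodule.smul_mem _ (if {Value.bit true} = m then (1 : ℝ) else 0) h1)
        (Submodule.smul_mem _ (if {Value.bit false} = m then (1 : ℝ) else 0) h0)
      convert h using 1
      ext x
      simp only [DDS.lookup_initialStore_input, Pi.add_apply, Pi.smul_apply, Pi.sub_apply,
        smul_eq_mul]
      cases hx : x i <;> simp
    · push Not at hk
      simpa [DDS.lookup_initialStore_of_ne _ hk] using const_mem_degreeLE _ 1
  | succ r ih =>
    -- Additivity of `φ` lets the number of machines drop out of the degree bound. A stopped machine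
    -- contributes `φ 0 = 0`, so this holds on invalid inputs too.
    have hwrites : ∀ φ : DDS N κ ν →+ ℝ,
        (fun x => φ (Algorithm.store S A x (r + 1))) ∈ degreeLE (Fin N) (S * S ^ (2 * r)) := by
      intro φ
      have h := Submodule.sum_mem (degreeLE (Fin N) (S * S ^ (2 * r))) fun v (_ : v ∈ Finset.univ) =>
        Program.readCost_ite_mem_degreeLE (fun k m => ih (Nat.le_of_succ_le hr) k m) φ (A r v) S
      convert h using 1
      ext x
      simp only [Algorithm.store, map_sum, Finset.sum_apply, Program.writes]
      exact Finset.sum_congr rfl fun v _ => by split_ifs <;> simp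
    have h := multiset_ite_mem_degreeLE (fun x => hkey x r hr k)
      (fun a => hwrites (AddMonoidHom.mk' (fun D => ((D.lookup k).count a : ℝ)) fun D E => by
        simp [DDS.lookup_add]))
      (hwrites (AddMonoidHom.mk' (fun D => ((D.lookup k).card : ℝ)) fun D E => by
        simp [DDS.lookup_add])) m
    convert h using 2
    ring

theorem Algorithm.ComputesIn.partialQueryComplexity_le {S R : ℕ} {A : Algorithm N κ ν M}
    {Δ : Set (Fin N → Bool)} {g : Δ → Bool} (hA : A.ComputesIn S R g) :
    partialQueryComplexity g ≤ S ^ (6 * R) := by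
  classical
  let f : (Fin N → Bool) → Bool := fun x =>
    decide ((Algorithm.store S A x R).lookup Key.answer = {Value.bit true})
  have hf : (fun x => if f x then (1 : ℝ) else 0) ∈ degreeLE (Fin N) (S ^ (2 * R)) := by
    simpa [f] using Algorithm.lookup_store_ite_mem_degreeLE hA.key_le le_rfl Key.answer
      {Value.bit true}
  have hfg : ∀ x : Δ, f x = g x := by
    intro x
    simp [f, hA.answer x, DDS.lookup, Multiset.filter_singleton]
  have hle : partialQueryComplexity g ≤ queryComplexity f := Nat.sInf_le ⟨f, hfg, rfl⟩
  refine hle.trans ((queryComplexity_le_cube hf).trans (le_of_eq ?_))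
  rw [← pow_mul]
  congr 1
  ring

end Computation

end AMPC

theorem mainTheorem8 {κ ν M : Type*} [Fintype M] (N S R : ℕ) (Δ : Set (Fin N → Bool))
    (g : Δ → Bool) (A : AMPC.Algorithm N κ ν M) (hA : A.ComputesIn S R g) :
    AMPC.partialQueryComplexity g ≤ 2 * S ^ (6 * R) ∧
      (2 ≤ S →
        (1 / 6 : ℝ) * Real.logb (S : ℝ) ((AMPC.partialQueryComplexity g : ℝ) / 2) ≤ (R : ℝ)) := by
  -- The factor `2` is slack.
  have hmain : AMPC.partialQueryComplexity g ≤ 2 * S ^ (6 * R) :=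
    hA.partialQueryComplexity_le.trans (Nat.le_mul_of_pos_left _ two_pos)
  refine ⟨hmain, fun hS => ?_⟩
  -- In the zero case `Real.logb S 0 = 0` by convention, so the claim reads `0 ≤ R`.
  rcases Nat.eq_zero_or_pos (AMPC.partialQueryComplexity g) with h0 | hpos
  · simp [h0]
  have hS1 : (1 : ℝ) < S := by exact_mod_cast hS
  have hlog : Real.logb S ((AMPC.partialQueryComplexity g : ℝ) / 2) ≤ 6 * R := by
    rw [Real.logb_le_iff_le_rpow hS1 (by positivity), div_le_iff₀' two_pos]
    have : ((S : ℝ) ^ (6 * (R : ℝ))) = (S : ℝ) ^ (6 * R) := by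
      rw [← Real.rpow_natCast]
      push_cast
      rfl
    rw [this]
    exact_mod_cast hmain
  linarith
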